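/- Let $G=(V,E)$ be a finite connected undirected graph, possibly with self-loops, where a self-loop contributes $2$ to the degree of its vertex. Let $\Delta$ be a real number such that every vertex has degree at most $\Delta$. For $v\in V$ let $N_v=\{u\in V: vu\in E\}$ be its set of neighbours (so $v\in N_v$ exactly when there is a self-loop at $v$). Give every edge conductance $1$, except that a self-loop has conductance $2$, and let $c_{uv}$ denote the conductance of $uv$, with $c_{uv}=0$ if $uv\notin E$. Fix $v_0\in V$ and let $\{\eta_v\}_{v\in V}$ be the Gaussian free field on $G$ with $\eta_{v_0}=0$, i.e. $\eta_{v_0}=0$ almost surely and $(\eta_v)_{v\ne v_0}$ has a density with respect to Lebesgue measure on $\mathbb R^{V\setminus\{v_0\}}$ proportional to $$\exp\Big(-\tfrac14\sum_{u,v\in V}c_{uv}|\eta_u-\eta_v|^2\Big).$$ Then for all $0\le\epsilon\le1$ and $M>0$, $$\mathbb P\left(\exists v\in V:\ M\le\eta_v\le M+\epsilon\left(1\wedge\frac{\Delta}{\sum_{u\in N_v}|M-\eta_u|}\right)\right)\ \ge\ \frac{2\epsilon}{10^{\Delta}}\;\mathbb P\Big(\sup_{v\in V}\eta_v\ge M\Big),$$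 where $1\wedge(\Delta/0)$ is read as $1$. -/

import Mathlib

open MeasureTheory ProbabilityTheory
open scoped BigOperators ENNReal

noncomputable section

namespace GaussianFreeField

variable {V : Type*} [Fintype V] [DecidableEq V]

/-! Throughout, a finite graph is given by its vertex set `V` and its edge set
`E : Finset (Sym2 V)`; self-loops `s(v, v)` are allowed. -/

/-- The graph `(V, E)` is connected (self-loops play no role in connectedness). -/
def IsConnected (E : Finset (Sym2 V)) : Prop :=
  (SimpleGraph.fromEdgeSet (E : Set (Sym2 V))).Connected

/-- The set `N_v` of neighbours of `v` (it contains `v` itself iff there is a self-loop at `v`). -/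
def neighbors (E : Finset (Sym2 V)) (v : V) : Finset V :=
  Finset.univ.filter fun u => s(v, u) ∈ E

/-- The conductances of the graph seen as an electric network: every edge has conductance `1`,
except that a self-loop has conductance `2`. -/
def conductance (E : Finset (Sym2 V)) (u v : V) : ℝ :=
  if s(u, v) ∈ E then (if u = v then 2 else 1) else 0

/-- The degree `d_v = c_v = ∑ u, c_{vu}` (a self-loop counts twice). -/
def degree (E : Finset (Sym2 V)) (v : V) : ℝ :=
  ∑ u, conductance E v u

/-- The field on `V` that vanishes at `v₀` and has the prescribed values elsewhere. -/
def pinned (v₀ : V) (x : {v : V // v ≠ v₀} → ℝ) : V → ℝ :=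
  fun v => if h : v = v₀ then 0 else x ⟨v, h⟩

/-- The quadratic form `(1/4) ∑_{u,v} c_{uv} |φ_u - φ_v|²`, the sum being over ordered pairs. -/
def energy (c : V → V → ℝ) (φ : V → ℝ) : ℝ :=
  1 / 4 * ∑ u, ∑ v, c u v * |φ u - φ v| ^ 2

/-- The measure on `ℝ^{V \ {v₀}}` with Lebesgue density `exp (-energy)`. -/
def unnormalized (c : V → V → ℝ) (v₀ : V) : Measure ({v : V // v ≠ v₀} → ℝ) :=
  volume.withDensity fun x => ENNReal.ofReal (Real.exp (-energy c (pinned v₀ x)))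

/-- The law on `ℝ^V` of the Gaussian free field of the network with conductances `c`, pinned to
`0` at `v₀`: the values off `v₀` have density proportional to `exp (-energy)`. -/
def gffLaw (c : V → V → ℝ) (v₀ : V) : Measure (V → ℝ) :=
  ((unnormalized c v₀ Set.univ)⁻¹ • unnormalized c v₀).map (pinned v₀)

/-- `η` is a Gaussian free field on the graph `(V, E)` with `η_{v₀} = 0`, defined on the
probability space `(Ω, P)`. -/
def IsGFF {Ω : Type*} [MeasurableSpace Ω] (E : Finset (Sym2 V)) (v₀ : V)
    (η : V → Ω → ℝ) (P : Measure Ω) : Prop :=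
  HasLaw (fun ω v => η v ω) (gffLaw (conductance E) v₀) P

/-- `1 ∧ (Δ / S)` for `S ≥ 0`, where `Δ / 0` is read as `+∞`. -/
def cappedRatio (Δ S : ℝ) : ℝ :=
  if S = 0 then 1 else min 1 (Δ / S)

end GaussianFreeField

end

/-! Reveal the field one vertex at a time, starting from the pinned vertex and always choosing a
vertex `v` joined by an edge to a revealed vertex `r`. Since the pinned value is `0 < M`, the
supremum reaches `M` exactly when some `v` is the first revealed vertex with value at least `M`. It
suffices to bound below, at that moment, the conditional probability that the overshoot at `v` is
small; these events are disjoint for different steps, so the bounds add up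
(`lmarginal_exists_smallOvershoot_ge`).

For one step (`lmarginal_smallOvershoot_ge`), let `U` be the set still unrevealed after `v`. The
field is `ψ + s • p + ζ`, where `ψ` is harmonic on `U` with the revealed values and with `M` at `v`,
`p` is the potential of `v`, and `ζ` is supported in `U`. The energy splits, so `ζ` is a field
pinned off `U`, independent of the overshoot `s`, whose density is proportional to `exp (-(s * a + s
^ 2 * b))`. Here `a` is the Laplacian of `ψ` at `v`, nonnegative by the maximum principle, and `b ≥
1 / 2` because of the edge `vr`. Such an `s`, conditioned to be positive, lies below `ε * κ / (1 +
a)` with probability at least `3 / 8 * ε * κ`.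

The same `a` controls the sum over the neighbours: for `s ≤ 1` it is at most `a + Δ + ∑ |ζ u|`. Each
neighbour in `U` has an edge to the pinned `v`, so `|ζ u|` has mean at most `1`, and Markov's
inequality bounds the last sum by `2 * Δ` with probability at least `1 / 2`. Then `κ / (1 + a)` lies
below the capped ratio for `κ = 1 / 3` (`exists_capped_bound`).

Conditioning is expressed by unnormalised integrals over the unrevealed coordinates with the others
fixed, so no conditional law is needed. -/

namespace GaussianFreeField

/-! ### Energy, harmonic functions and potentials on a network -/

section Network

variable {V : Type*} [Fintype V]

/-- The Laplacian `(Lφ)_u = ∑_w c_{uw} (φ_u - φ_w)` of a network. -/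
def laplacian (c : V → V → ℝ) : (V → ℝ) →ₗ[ℝ] (V → ℝ) where
  toFun φ u := ∑ w, c u w * (φ u - φ w)
  map_add' φ ψ := by
    funext u
    simp only [Pi.add_apply, ← Finset.sum_add_distrib]
    exact Finset.sum_congr rfl fun w _ => by ring
  map_smul' a φ := by
    funext u
    simp only [Pi.smul_apply, smul_eq_mul, RingHom.id_apply, Finset.mul_sum]
    exact Finset.sum_congr rfl fun w _ => by ring

theorem laplacian_apply (c : V → V → ℝ) (φ : V → ℝ) (u : V) :
    laplacian c φ u = ∑ w, c u w * (φ u - φ w) := rfl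

variable {c : V → V → ℝ}

theorem sum_mul_laplacian (hs : ∀ u v, c u v = c v u) (φ ψ : V → ℝ) :
    ∑ u, ψ u * laplacian c φ u = 1 / 2 * ∑ u, ∑ w, c u w * ((φ u - φ w) * (ψ u - ψ w)) := by
  have h1 : ∑ u, ψ u * laplacian c φ u = ∑ u, ∑ w, c u w * ((φ u - φ w) * ψ u) := by
    refine Finset.sum_congr rfl fun u _ => ?_
    rw [laplacian_apply, Finset.mul_sum]
    exact Finset.sum_congr rfl fun w _ => by ring
  have h2 : ∑ u, ∑ w, c u w * ((φ u - φ w) * ψ u)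
      = ∑ u, ∑ w, c u w * ((φ w - φ u) * ψ w) := by
    rw [Finset.sum_comm]
    refine Finset.sum_congr rfl fun u _ => Finset.sum_congr rfl fun w _ => ?_
    rw [hs]
  have h3 : ∑ u, ∑ w, c u w * ((φ u - φ w) * (ψ u - ψ w))
      = ∑ u, ∑ w, c u w * ((φ u - φ w) * ψ u) + ∑ u, ∑ w, c u w * ((φ w - φ u) * ψ w) := by
    simp only [← Finset.sum_add_distrib]
    exact Finset.sum_congr rfl fun u _ => Finset.sum_congr rfl fun w _ => by ring
  rw [h1, h3, ← h2]
  ring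

theorem energy_eq_sum_mul_laplacian (hs : ∀ u v, c u v = c v u) (φ : V → ℝ) :
    energy c φ = 1 / 2 * ∑ u, φ u * laplacian c φ u := by
  rw [sum_mul_laplacian hs, energy]
  simp only [sq_abs, ← pow_two]
  ring

theorem energy_add (hs : ∀ u v, c u v = c v u) (φ ψ : V → ℝ) :
    energy c (φ + ψ) = energy c φ + energy c ψ + ∑ u, ψ u * laplacian c φ u := by
  rw [sum_mul_laplacian hs]
  simp only [energy, Finset.mul_sum, ← Finset.sum_add_distrib, Pi.add_apply, sq_abs]
  exact Finset.sum_congr rfl fun u _ => Finset.sum_congr rfl fun w _ => by ring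

theorem energy_smul (a : ℝ) (φ : V → ℝ) : energy c (a • φ) = a ^ 2 * energy c φ := by
  simp only [energy, Finset.mul_sum, Pi.smul_apply, smul_eq_mul, sq_abs]
  exact Finset.sum_congr rfl fun u _ => Finset.sum_congr rfl fun w _ => by ring

theorem energy_nonneg (hc : ∀ u v, 0 ≤ c u v) (φ : V → ℝ) : 0 ≤ energy c φ :=
  mul_nonneg (by norm_num) <| Finset.sum_nonneg fun u _ => Finset.sum_nonneg fun w _ =>
    mul_nonneg (hc u w) (sq_nonneg _)

/-- If `φ` is harmonic on `U` and `ζ` is supported in `U`, then the energies add up. -/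
theorem energy_add_of_harmonic (hs : ∀ u v, c u v = c v u) {U : Finset V} {φ ζ : V → ℝ}
    (hφ : ∀ u ∈ U, laplacian c φ u = 0) (hζ : ∀ u ∉ U, ζ u = 0) :
    energy c (φ + ζ) = energy c φ + energy c ζ := by
  rw [energy_add hs, Finset.sum_eq_zero, add_zero]
  intro u _
  by_cases hu : u ∈ U
  · rw [hφ u hu, mul_zero]
  · rw [hζ u hu, zero_mul]

/-- The Dirichlet problem is a square linear system, so uniqueness gives existence: a solution with
zero boundary data has zero energy, hence is constant, hence vanishes because it does so at `v₀`. -/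
theorem exists_harmonic_extension [DecidableEq V] (hs : ∀ u v, c u v = c v u)
    (hconst : ∀ φ : V → ℝ, energy c φ = 0 → ∀ u v, φ u = φ v)
    {U : Finset V} {v₀ : V} (hv₀ : v₀ ∉ U) (φ : V → ℝ) :
    ∃ ψ : V → ℝ, (∀ u ∈ U, laplacian c ψ u = 0) ∧ ∀ u ∉ U, ψ u = φ u := by
  let ext : (U → ℝ) →ₗ[ℝ] (V → ℝ) :=
    { toFun := fun g u => if h : u ∈ U then g ⟨u, h⟩ else 0
      map_add' := fun f g => by funext u; by_cases h : u ∈ U <;> simp [h]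
      map_smul' := fun a g => by funext u; by_cases h : u ∈ U <;> simp [h] }
  have ext_mem : ∀ g (u : U), ext g u = g u := fun g u => by
    change (if h : (u : V) ∈ U then g ⟨u, h⟩ else 0) = g u
    simp
  have ext_notMem : ∀ g u, u ∉ U → ext g u = 0 := fun g u hu => by
    change (if h : u ∈ U then g ⟨u, h⟩ else 0) = 0
    simp [hu]
  let T : (U → ℝ) →ₗ[ℝ] (U → ℝ) := (LinearMap.funLeft ℝ ℝ Subtype.val).comp
    ((laplacian c).comp ext)
  have hT : ∀ g (u : U), T g u = laplacian c (ext g) u := fun g u => rfl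
  have hinj : Function.Injective T := by
    rw [← LinearMap.ker_eq_bot, LinearMap.ker_eq_bot']
    intro g hg
    have h0 : energy c (ext g) = 0 := by
      rw [energy_eq_sum_mul_laplacian hs, Finset.sum_eq_zero, mul_zero]
      intro u _
      by_cases hu : u ∈ U
      · have := hT g ⟨u, hu⟩
        rw [hg] at this
        rw [← this, Pi.zero_apply, mul_zero]
      · rw [ext_notMem g u hu, zero_mul]
    funext u
    rw [← ext_mem g u, hconst _ h0 u v₀, ext_notMem g v₀ hv₀]
    rfl
  obtain ⟨g, hg⟩ := (LinearMap.injective_iff_surjective.mp hinj) fun u => - laplacian c φ u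
  refine ⟨φ + ext g, fun u hu => ?_, fun u hu => ?_⟩
  · have := congrFun hg ⟨u, hu⟩
    rw [hT] at this
    rw [map_add, Pi.add_apply, this, add_neg_cancel]
  · rw [Pi.add_apply, ext_notMem g u hu, add_zero]

/-- Maximum principle, by testing harmonicity against the positive part of `ψ - K`. Truncation only
shrinks increments and keeps their sign, so this positive part has zero energy; it is then constant,
and zero at `v₀`. -/
theorem harmonic_le (hs : ∀ u v, c u v = c v u) (hc : ∀ u v, 0 ≤ c u v)
    (hconst : ∀ φ : V → ℝ, energy c φ = 0 → ∀ u v, φ u = φ v)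
    {U : Finset V} {v₀ : V} (hv₀ : v₀ ∉ U) {ψ : V → ℝ} {K : ℝ}
    (hψ : ∀ u ∈ U, laplacian c ψ u = 0) (hK : ∀ u ∉ U, ψ u ≤ K) (u : V) : ψ u ≤ K := by
  let w : V → ℝ := fun u => max (ψ u - K) 0
  have hw : ∀ u ∉ U, w u = 0 := fun u hu => max_eq_right (by linarith [hK u hu])
  have h1 : ∑ u, w u * laplacian c ψ u = 0 := Finset.sum_eq_zero fun u _ => by
    by_cases hu : u ∈ U
    · rw [hψ u hu, mul_zero]
    · rw [hw u hu, zero_mul]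
  have h2 : energy c w = 0 := by
    refine le_antisymm ?_ (energy_nonneg hc w)
    have : 2 * energy c w ≤ ∑ u, w u * laplacian c ψ u := by
      rw [sum_mul_laplacian hs, energy]
      simp only [Finset.mul_sum, sq_abs]
      refine Finset.sum_le_sum fun u _ => Finset.sum_le_sum fun x _ => ?_
      have key : (w u - w x) ^ 2 ≤ (ψ u - ψ x) * (w u - w x) := by
        simp only [w]
        rcases max_cases (ψ u - K) 0 with ⟨a, b⟩ | ⟨a, b⟩ <;>
          rcases max_cases (ψ x - K) 0 with ⟨a₁, b₁⟩ | ⟨a₁, b₁⟩ <;> rw [a, a₁] <;> nlinarith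
      nlinarith [mul_le_mul_of_nonneg_left key (hc u x)]
    linarith
  have h3 : w u = 0 := by rw [hconst w h2 u v₀, hw v₀ hv₀]
  have := le_max_left (ψ u - K) 0
  change max (ψ u - K) 0 = 0 at h3
  linarith

theorem le_harmonic (hs : ∀ u v, c u v = c v u) (hc : ∀ u v, 0 ≤ c u v)
    (hconst : ∀ φ : V → ℝ, energy c φ = 0 → ∀ u v, φ u = φ v)
    {U : Finset V} {v₀ : V} (hv₀ : v₀ ∉ U) {ψ : V → ℝ} {K : ℝ}
    (hψ : ∀ u ∈ U, laplacian c ψ u = 0) (hK : ∀ u ∉ U, K ≤ ψ u) (u : V) : K ≤ ψ u := by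
  have := harmonic_le hs hc hconst hv₀ (ψ := -ψ) (K := -K)
    (fun u hu => by rw [map_neg, Pi.neg_apply, hψ u hu, neg_zero])
    (fun u hu => neg_le_neg (hK u hu)) u
  exact neg_le_neg_iff.mp this

/-- The potential of the unit at `v`: harmonic on `U`, equal to `1` at `v` and to `0` off `U`
elsewhere. -/
theorem exists_potential [DecidableEq V] (hs : ∀ u v, c u v = c v u) (hc : ∀ u v, 0 ≤ c u v)
    (hconst : ∀ φ : V → ℝ, energy c φ = 0 → ∀ u v, φ u = φ v)
    {U : Finset V} {v₀ v : V} (hv₀ : v₀ ∉ insert v U) (hv : v ∉ U) :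
    ∃ p : V → ℝ, (∀ u ∈ U, laplacian c p u = 0) ∧ p v = 1 ∧ (∀ u ∉ insert v U, p u = 0) ∧
      (∀ u, 0 ≤ p u) ∧ (∀ u, p u ≤ 1) ∧ 0 < laplacian c p v ∧
      ∀ r ∉ insert v U, c v r ≤ laplacian c p v := by
  have hv₀' : v₀ ∉ U := fun h => hv₀ (Finset.mem_insert_of_mem h)
  obtain ⟨p, hp, hpe⟩ := exists_harmonic_extension hs hconst hv₀' (Pi.single v 1)
  have hpv : p v = 1 := by rw [hpe v hv, Pi.single_eq_same]
  have hp0 : ∀ u ∉ insert v U, p u = 0 := fun u hu => by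
    rw [Finset.mem_insert, not_or] at hu
    rw [hpe u hu.2, Pi.single_eq_of_ne hu.1]
  have h0 : ∀ u, 0 ≤ p u := le_harmonic hs hc hconst hv₀' hp fun u hu => by
    by_cases h : u = v
    · rw [h, hpv]; exact zero_le_one
    · rw [hp0 u (by simp [h, hu])]
  have h1 : ∀ u, p u ≤ 1 := harmonic_le hs hc hconst hv₀' hp fun u hu => by
    by_cases h : u = v
    · rw [h, hpv]
    · rw [hp0 u (by simp [h, hu])]; exact zero_le_one
  have hterm : ∀ w, 0 ≤ c v w * (p v - p w) := fun w =>
    mul_nonneg (hc v w) (by rw [hpv]; linarith [h1 w])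
  -- The Laplacian at `v` is the effective conductance from `v` to the complement of `insert v U`.
  -- It is positive because `p` is not constant, and it dominates each of its nonnegative terms, in
  -- particular that of an edge to `r`.
  have hE : energy c p = 1 / 2 * laplacian c p v := by
    rw [energy_eq_sum_mul_laplacian hs, Finset.sum_eq_single v, hpv, one_mul]
    · intro u _ huv
      by_cases hu : u ∈ U
      · rw [hp u hu, mul_zero]
      · rw [hp0 u (by simp [hu, huv]), zero_mul]
    · simp
  refine ⟨p, hp, hpv, hp0, h0, h1, ?_, fun r hr => ?_⟩
  · refine lt_of_le_of_ne (Finset.sum_nonneg fun w _ => hterm w) fun h => ?_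
    rw [← h, mul_zero] at hE
    have := hconst p hE v v₀
    rw [hpv, hp0 v₀ hv₀] at this
    exact one_ne_zero this
  · have := Finset.single_le_sum (fun w _ => hterm w) (Finset.mem_univ r)
    rw [hpv, hp0 r hr, sub_zero, mul_one] at this
    rw [laplacian_apply]
    simpa [hpv] using this

end Network

/-! ### Consequences of connectedness and of the choice of conductances -/

section Graph

theorem conductance_comm {V : Type*} [DecidableEq V] (E : Finset (Sym2 V)) (u v : V) :
    conductance E u v = conductance E v u := by
  simp only [conductance, Sym2.eq_swap (a := u), eq_comm (a := u)]

theorem conductance_nonneg {V : Type*} [DecidableEq V] (E : Finset (Sym2 V)) (u v : V) : 0 ≤ conductance E u v := by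
  unfold conductance
  split_ifs <;> norm_num

theorem one_le_conductance {V : Type*} [DecidableEq V] {E : Finset (Sym2 V)} {u v : V} (h : s(u, v) ∈ E) : 1 ≤ conductance E u v := by
  unfold conductance
  split_ifs <;> norm_num

theorem eq_of_energy_eq_zero {V : Type*} [Fintype V] [DecidableEq V] {E : Finset (Sym2 V)}
    (hconn : IsConnected E) (φ : V → ℝ)
    (h : energy (conductance E) φ = 0) (u v : V) : φ u = φ v := by
  have hterm : ∀ u w, 0 ≤ conductance E u w * |φ u - φ w| ^ 2 := fun u w =>
    mul_nonneg (conductance_nonneg E u w) (sq_nonneg _)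
  have hedge : ∀ u w, s(u, w) ∈ E → φ u = φ w := fun u w huw => by
    have h0 : ∑ u, ∑ w, conductance E u w * |φ u - φ w| ^ 2 = 0 := by
      unfold energy at h; linarith
    rw [Finset.sum_eq_zero_iff_of_nonneg fun u _ => Finset.sum_nonneg fun w _ => hterm u w] at h0
    have h1 := h0 u (Finset.mem_univ u)
    rw [Finset.sum_eq_zero_iff_of_nonneg fun w _ => hterm u w] at h1
    have h2 := h1 w (Finset.mem_univ w)
    have h3 := one_le_conductance huw
    have h4 : |φ u - φ w| ^ 2 = 0 := by
      rcases mul_eq_zero.mp h2 with h' | h'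
      · linarith
      · exact h'
    exact sub_eq_zero.mp (abs_eq_zero.mp (pow_eq_zero_iff two_ne_zero |>.mp h4))
  obtain ⟨p⟩ := hconn.preconnected u v
  induction p with
  | nil => rfl
  | cons hadj _ ih => exact (hedge _ _ ((SimpleGraph.fromEdgeSet_adj _).mp hadj).1).trans ih

theorem exists_edge_boundary {V : Type*} {E : Finset (Sym2 V)} (hconn : IsConnected E)
    {R : Finset V} {v₀ w : V} (hv₀ : v₀ ∈ R)
    (hw : w ∉ R) : ∃ v ∉ R, ∃ r ∈ R, s(v, r) ∈ E := by
  obtain ⟨p⟩ := hconn.preconnected v₀ w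
  obtain ⟨d, -, h1, h2⟩ := p.exists_boundary_dart (R : Set V) (by simpa) (by simpa)
  refine ⟨d.snd, by simpa using h2, d.fst, by simpa using h1, ?_⟩
  have := ((SimpleGraph.fromEdgeSet_adj _).mp d.adj).1
  rw [Sym2.eq_swap]
  exact_mod_cast this

end Graph

/-! ### One-dimensional Gaussian estimates -/

section OneDimensional

open Set

theorem integrableOn_exp_neg_linear_add_sq {a b : ℝ} (ha : 0 ≤ a) (hb : 0 < b) :
    IntegrableOn (fun s : ℝ => Real.exp (-(s * a + s ^ 2 * b))) (Ioi 0) := by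
  refine Integrable.mono' (integrable_exp_neg_mul_sq hb).integrableOn
    (by fun_prop) ?_
  refine (ae_restrict_iff' measurableSet_Ioi).mpr (ae_of_all _ fun s hs => ?_)
  rw [Real.norm_of_nonneg (Real.exp_pos _).le]
  refine Real.exp_le_exp.mpr ?_
  have : 0 ≤ s * a := mul_nonneg (le_of_lt hs) ha
  linarith

theorem antitoneOn_exp_neg_linear_add_sq {a b : ℝ} (ha : 0 ≤ a) (hb : 0 ≤ b) :
    AntitoneOn (fun s : ℝ => Real.exp (-(s * a + s ^ 2 * b))) (Ici 0) := by
  intro x hx y _ hxy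
  have hx : 0 ≤ x := hx
  refine Real.exp_le_exp.mpr (neg_le_neg ?_)
  gcongr

theorem exp_neg_half_le : Real.exp (-(1 / 2)) ≤ 5 / 8 := by
  have h : (1 : ℝ) / 2 + 1 + (1 / 2) ^ 2 / 2 ≤ Real.exp (1 / 2) := by
    have := Real.quadratic_le_exp_of_nonneg (x := 1 / 2) (by norm_num)
    linarith
  rw [Real.exp_neg, inv_le_comm₀ (Real.exp_pos _) (by norm_num)]
  linarith

/-- Moving by `1 / (1 + a)` multiplies the density by at most `exp (-1 / 2) ≤ 5 / 8`, so the tail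
beyond this point carries at most `5 / 8` of the mass. -/
theorem integral_Ioi_le_integral_interval {a b : ℝ} (ha : 0 ≤ a) (hb : 1 / 2 ≤ b) :
    3 / 8 * ∫ s in Ioi (0 : ℝ), Real.exp (-(s * a + s ^ 2 * b)) ≤
      ∫ s in (0 : ℝ)..(1 / (1 + a)), Real.exp (-(s * a + s ^ 2 * b)) := by
  set f : ℝ → ℝ := fun s => Real.exp (-(s * a + s ^ 2 * b)) with hf
  set L : ℝ := 1 / (1 + a) with hL
  have hL0 : 0 < L := by positivity
  have hLa : L * a = 1 - L := by rw [hL]; field_simp; ring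
  have hint : IntegrableOn f (Ioi 0) := integrableOn_exp_neg_linear_add_sq ha (by linarith)
  have hintL : IntegrableOn f (Ioi L) := hint.mono_set (Ioi_subset_Ioi hL0.le)
  have hsplit := intervalIntegral.integral_interval_add_Ioi hint hintL
  have hpre : (fun s => s + L) ⁻¹' Ioi L = Ioi (0 : ℝ) := by ext s; simp
  have hmp := measurePreserving_add_right (volume : Measure ℝ) L
  have hshift : ∫ s in Ioi L, f s = ∫ s in Ioi (0 : ℝ), f (s + L) := by
    rw [← hmp.setIntegral_preimage_emb (measurableEmbedding_addRight L) f (Ioi L), hpre]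
  have hintS : IntegrableOn (fun s => f (s + L)) (Ioi 0) := by
    rw [← hpre]
    exact (hmp.integrableOn_comp_preimage (measurableEmbedding_addRight L)).mpr hintL
  have hle : ∫ s in Ioi (0 : ℝ), f (s + L) ≤ ∫ s in Ioi (0 : ℝ), 5 / 8 * f s := by
    refine setIntegral_mono_on hintS (hint.const_mul _) measurableSet_Ioi fun s hs => ?_
    have hs : 0 < s := hs
    refine le_trans ?_ (mul_le_mul_of_nonneg_right exp_neg_half_le (Real.exp_pos _).le)
    rw [hf, ← Real.exp_add]
    refine Real.exp_le_exp.mpr ?_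
    have h1 : 0 ≤ s * L * b := by positivity
    have h2 : L ^ 2 * (1 / 2) ≤ L ^ 2 * b := by gcongr
    -- The exponent grows by at least `L * a + L ^ 2 / 2 = 1 - L + L ^ 2 / 2`, which is `((L - 1) ^
    -- 2 + 1) / 2`.
    nlinarith [sq_nonneg (L - 1)]
  rw [integral_const_mul] at hle
  linarith

/-- The average of a decreasing function over a shorter initial interval is larger: compare both
pieces with the value at `t`. -/
theorem mul_integral_interval_le {f : ℝ → ℝ} {t L : ℝ} (hf : AntitoneOn f (Ici 0))
    (ht : 0 ≤ t) (htL : t ≤ L) :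
    t * ∫ s in (0 : ℝ)..L, f s ≤ L * ∫ s in (0 : ℝ)..t, f s := by
  have hi : ∀ x y : ℝ, 0 ≤ x → x ≤ y → IntervalIntegrable f volume x y := fun x y hx hxy =>
    (hf.mono (by rw [uIcc_of_le hxy]; exact fun z hz => hx.trans hz.1)).intervalIntegrable
  have hsplit := intervalIntegral.integral_add_adjacent_intervals (hi 0 t le_rfl ht) (hi t L ht htL)
  have h1 : t * f t ≤ ∫ s in (0 : ℝ)..t, f s := by
    have := intervalIntegral.integral_mono_on ht (intervalIntegrable_const (c := f t))
      (hi 0 t le_rfl ht) fun x hx => hf hx.1 ht hx.2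
    simpa using this
  have h2 : ∫ s in t..L, f s ≤ (L - t) * f t := by
    have := intervalIntegral.integral_mono_on htL (hi t L ht htL)
      (intervalIntegrable_const (c := f t)) fun x hx => hf ht (ht.trans hx.1) hx.1
    simpa using this
  rw [← hsplit]
  nlinarith [mul_le_mul_of_nonneg_left h2 ht, mul_le_mul_of_nonneg_left h1 (sub_nonneg.mpr htL)]

/-- A Gaussian conditioned to overshoot a level above its mean overshoots by at most `t` with
probability at least of order `t (1 + a)`, where `a` is the drift towards the mean. -/
theorem lintegral_Ioi_le_lintegral_Ioc {a b t : ℝ} (ha : 0 ≤ a) (hb : 1 / 2 ≤ b) (ht : 0 ≤ t)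
    (hta : t * (1 + a) ≤ 1) :
    ENNReal.ofReal (3 / 8 * (t * (1 + a))) *
        ∫⁻ s in Ioi (0 : ℝ), ENNReal.ofReal (Real.exp (-(s * a + s ^ 2 * b))) ≤
      ∫⁻ s in Ioc 0 t, ENNReal.ofReal (Real.exp (-(s * a + s ^ 2 * b))) := by
  have hint := integrableOn_exp_neg_linear_add_sq ha (show 0 < b by linarith)
  rw [← ofReal_integral_eq_lintegral_ofReal hint (ae_of_all _ fun s => (Real.exp_pos _).le),
    ← ofReal_integral_eq_lintegral_ofReal (hint.mono_set Ioc_subset_Ioi_self)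
      (ae_of_all _ fun s => (Real.exp_pos _).le), ← ENNReal.ofReal_mul (by positivity),
    ← intervalIntegral.integral_of_le ht]
  refine ENNReal.ofReal_le_ofReal ?_
  have htL : t ≤ 1 / (1 + a) := by rwa [le_div_iff₀ (by positivity)]
  have h1 := integral_Ioi_le_integral_interval ha hb
  have h2 := mul_integral_interval_le
    (antitoneOn_exp_neg_linear_add_sq ha (show 0 ≤ b by linarith)) ht htL
  rw [div_mul_eq_mul_div, one_mul, le_div_iff₀ (by positivity)] at h2
  refine le_trans ?_ h2
  nlinarith [mul_le_mul_of_nonneg_left h1 (show 0 ≤ t * (1 + a) by positivity)]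

theorem lintegral_gaussian_lt_top {b : ℝ} (hb : 0 < b) :
    ∫⁻ s : ℝ, ENNReal.ofReal (Real.exp (-(s ^ 2 * b))) < ∞ := by
  have := (integrable_exp_neg_mul_sq hb).lintegral_lt_top
  simpa [mul_comm] using this

theorem lintegral_abs_mul_gaussian_le {b : ℝ} (hb : 1 / 2 ≤ b) :
    ∫⁻ s : ℝ, ENNReal.ofReal |s| * ENNReal.ofReal (Real.exp (-(s ^ 2 * b))) ≤
      ∫⁻ s : ℝ, ENNReal.ofReal (Real.exp (-(s ^ 2 * b))) := by
  have hb0 : 0 < b := by linarith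
  have hi1 : Integrable fun s : ℝ => Real.exp (-(s ^ 2 * b)) := by
    simpa [mul_comm] using integrable_exp_neg_mul_sq hb0
  have hi2 : Integrable fun s : ℝ => |s| * Real.exp (-(s ^ 2 * b)) := by
    have := (integrable_mul_exp_neg_mul_sq hb0).norm
    refine this.congr (ae_of_all _ fun s => ?_)
    simp only [norm_mul, Real.norm_eq_abs, Real.abs_exp]
    ring_nf
  simp_rw [← ENNReal.ofReal_mul (abs_nonneg _)]
  rw [← ofReal_integral_eq_lintegral_ofReal hi1 (ae_of_all _ fun s => (Real.exp_pos _).le),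
    ← ofReal_integral_eq_lintegral_ofReal hi2 (ae_of_all _ fun s => by positivity)]
  refine ENNReal.ofReal_le_ofReal ?_
  have h1 : ∫ s : ℝ, Real.exp (-(s ^ 2 * b)) = √(Real.pi / b) := by
    rw [← integral_gaussian]
    simp [mul_comm]
  have h2 : ∫ s : ℝ, |s| * Real.exp (-(s ^ 2 * b)) = 1 / b := by
    have e1 : ∫ s : ℝ, |s| * Real.exp (-(s ^ 2 * b))
        = ∫ s : ℝ, (fun r => r ^ (1 : ℝ) * Real.exp (-b * r ^ (2 : ℝ))) |s| := by
      congr 1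
      funext s
      simp [mul_comm]
    rw [e1, integral_comp_abs (f := fun r => r ^ (1 : ℝ) * Real.exp (-b * r ^ (2 : ℝ))),
      integral_rpow_mul_exp_neg_mul_rpow two_pos (by norm_num) hb0]
    norm_num
    rw [Real.rpow_neg_one]
    ring
  rw [h1, h2]
  -- The claim is now `1 / b ≤ √(π / b)`, that is `1 ≤ π * b`.
  refine Real.le_sqrt_of_sq_le ?_
  rw [div_pow, one_pow, pow_two, div_le_div_iff₀ (by positivity) hb0]
  nlinarith [Real.pi_gt_three, mul_pos hb0 hb0]

end OneDimensional

/-! ### The Gaussian weight -/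

section Weight

variable {V : Type*} [Fintype V] {c : V → V → ℝ}

/-- The Gaussian weight `exp (-energy)`. -/
noncomputable def weight (c : V → V → ℝ) (φ : V → ℝ) : ℝ≥0∞ := ENNReal.ofReal (Real.exp (-energy c φ))

theorem measurable_weight (c : V → V → ℝ) : Measurable (weight c) := by
  unfold weight energy
  fun_prop

theorem weight_ne_top (φ : V → ℝ) : weight c φ ≠ ∞ := ENNReal.ofReal_ne_top

end Weight

/-! ### Integration over some coordinates and the Markov property -/

section Marginal

variable {V : Type*} [DecidableEq V] {U : Finset V}

theorem updateFinset_zero_of_notMem (y : U → ℝ) {u : V} (hu : u ∉ U) :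
    Function.updateFinset (0 : V → ℝ) U y u = 0 := by
  simp [Function.updateFinset, hu]

theorem lmarginal_zero_mono {f g : (V → ℝ) → ℝ≥0∞}
    (h : ∀ ζ : V → ℝ, (∀ u ∉ U, ζ u = 0) → f ζ ≤ g ζ) :
    (∫⋯∫⁻_U, f) 0 ≤ (∫⋯∫⁻_U, g) 0 :=
  lintegral_mono fun y => h _ fun _ hu => updateFinset_zero_of_notMem y hu

theorem lmarginal_zero_congr {f g : (V → ℝ) → ℝ≥0∞}
    (h : ∀ ζ : V → ℝ, (∀ u ∉ U, ζ u = 0) → f ζ = g ζ) :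
    (∫⋯∫⁻_U, f) 0 = (∫⋯∫⁻_U, g) 0 :=
  lintegral_congr fun y => h _ fun _ hu => updateFinset_zero_of_notMem y hu

theorem lmarginal_const_mul {f : (V → ℝ) → ℝ≥0∞} (hf : Measurable f) (r : ℝ≥0∞) (x : V → ℝ) :
    (∫⋯∫⁻_U, fun φ => r * f φ) x = r * (∫⋯∫⁻_U, f) x :=
  lintegral_const_mul r (hf.comp measurable_updateFinset)

theorem lmarginal_add {f g : (V → ℝ) → ℝ≥0∞} (hf : Measurable f) (x : V → ℝ) :
    (∫⋯∫⁻_U, fun φ => f φ + g φ) x = (∫⋯∫⁻_U, f) x + (∫⋯∫⁻_U, g) x :=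
  lintegral_add_left (hf.comp measurable_updateFinset) _

theorem lmarginal_sum {ι : Type*} (s : Finset ι) {f : ι → (V → ℝ) → ℝ≥0∞}
    (hf : ∀ i, Measurable (f i)) (x : V → ℝ) :
    (∫⋯∫⁻_U, fun φ => ∑ i ∈ s, f i φ) x = ∑ i ∈ s, (∫⋯∫⁻_U, f i) x :=
  lintegral_finsetSum s fun i _ => (hf i).comp measurable_updateFinset

/-- Translation invariance of the marginal integral. -/
theorem lmarginal_eq_lmarginal_add (f : (V → ℝ) → ℝ≥0∞) {x ψ : V → ℝ}
    (h : ∀ u ∉ U, ψ u = x u) :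
    (∫⋯∫⁻_U, f) x = (∫⋯∫⁻_U, fun ζ => f (ψ + ζ)) 0 := by
  unfold lmarginal
  rw [← volume_pi, ← lintegral_add_right_eq_self _ fun u : U => ψ u]
  refine lintegral_congr fun y => congrArg f ?_
  funext u
  by_cases hu : u ∈ U
  · simp [Function.updateFinset, hu, add_comm]
  · simp [Function.updateFinset, hu, h u hu]

variable [Fintype V] {c : V → V → ℝ}

/-- The Markov property: given the values off `U`, the field is their harmonic extension plus a
field pinned to zero off `U`, since the cross term of the energy vanishes. -/
theorem lmarginal_mul_weight (hs : ∀ u v, c u v = c v u) {G : (V → ℝ) → ℝ≥0∞}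
    (hG : Measurable G) {x ψ : V → ℝ} (hψ : ∀ u ∈ U, laplacian c ψ u = 0)
    (h : ∀ u ∉ U, ψ u = x u) :
    (∫⋯∫⁻_U, fun φ => G φ * weight c φ) x
      = weight c ψ * (∫⋯∫⁻_U, fun ζ => G (ψ + ζ) * weight c ζ) 0 := by
  have hm : Measurable fun ζ => G (ψ + ζ) * weight c ζ :=
    (hG.comp (measurable_const_add ψ)).mul (measurable_weight c)
  rw [lmarginal_eq_lmarginal_add _ h, ← lmarginal_const_mul hm]
  refine lmarginal_zero_congr fun ζ hζ => ?_
  have : weight c (ψ + ζ) = weight c ψ * weight c ζ := by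
    unfold weight
    rw [energy_add_of_harmonic hs hψ hζ, ← ENNReal.ofReal_mul (Real.exp_pos _).le,
      ← Real.exp_add, neg_add]
  rw [this]
  ring

/-- Fibre integration over `insert v U`, parametrising the value at `v` as `ψ v + s`. -/
theorem lmarginal_insert_mul_weight (hs : ∀ u v, c u v = c v u) {v : V} (hv : v ∉ U)
    {G : (V → ℝ) → ℝ≥0∞} (hG : Measurable G) {x ψ p : V → ℝ}
    (hψ : ∀ u ∈ U, laplacian c ψ u = 0) (hψx : ∀ u ∉ insert v U, ψ u = x u)
    (hp : ∀ u ∈ U, laplacian c p u = 0) (hpv : p v = 1) (hp0 : ∀ u ∉ insert v U, p u = 0) :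
    (∫⋯∫⁻_insert v U, fun φ => G φ * weight c φ) x
      = weight c ψ * ∫⁻ s : ℝ, ENNReal.ofReal
          (Real.exp (-(s * laplacian c ψ v + s ^ 2 * (laplacian c p v / 2)))) *
            (∫⋯∫⁻_U, fun ζ => G (ψ + s • p + ζ) * weight c ζ) 0 := by
  have hsum : ∀ f : V → ℝ, (∀ u ∈ U, f u = 0) → ∑ u, p u * f u = f v := fun f hf => by
    rw [Finset.sum_eq_single v, hpv, one_mul]
    · intro u _ huv
      by_cases hu : u ∈ U
      · rw [hf u hu, mul_zero]
      · rw [hp0 u (by simp [hu, huv]), zero_mul]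
    · simp
  rw [lmarginal_insert (fun φ => G φ * weight c φ) (hG.mul (measurable_weight c)) hv,
    ← lintegral_add_right_eq_self _ (ψ v), ← lintegral_const_mul' _ _ (weight_ne_top ψ)]
  refine lintegral_congr fun s => ?_
  rw [lmarginal_mul_weight hs hG (ψ := ψ + s • p), ← mul_assoc]
  · congr 1
    unfold weight
    rw [← ENNReal.ofReal_mul (Real.exp_pos _).le, ← Real.exp_add, energy_add hs, energy_smul,
      energy_eq_sum_mul_laplacian hs p, hsum _ hp]
    have : ∑ u, (s • p) u * laplacian c ψ u = s * laplacian c ψ v := by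
      rw [← hsum _ hψ, Finset.mul_sum]
      exact Finset.sum_congr rfl fun u _ => by rw [Pi.smul_apply, smul_eq_mul, mul_assoc]
    rw [this]
    ring_nf
  · intro u hu
    simp [hψ u hu, hp u hu]
  · intro u hu
    by_cases huv : u = v
    · subst huv
      simp [hpv, add_comm]
    · have : u ∉ insert v U := by simp [hu, huv]
      simp [huv, hψx u this, hp0 u this]

end Marginal

/-! ### Moments of the pinned field -/

section Moments

variable {V : Type*} [Fintype V] [DecidableEq V] {c : V → V → ℝ} {U : Finset V} {v₀ : V}

/-- The partition function factorises along the value at one vertex. -/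
theorem lmarginal_insert_weight (hs : ∀ u v, c u v = c v u) {v : V} (hv : v ∉ U) {p : V → ℝ}
    (hp : ∀ u ∈ U, laplacian c p u = 0) (hpv : p v = 1) (hp0 : ∀ u ∉ insert v U, p u = 0)
    {g : ℝ → ℝ≥0∞} (hg : Measurable g) :
    (∫⋯∫⁻_insert v U, fun φ => g (φ v) * weight c φ) 0 =
      (∫⁻ s : ℝ, g s * ENNReal.ofReal (Real.exp (-(s ^ 2 * (laplacian c p v / 2))))) *
        (∫⋯∫⁻_U, weight c) 0 := by
  rw [lmarginal_insert_mul_weight hs hv (G := fun φ => g (φ v)) (hg.comp (measurable_pi_apply v))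
    (ψ := 0) (fun u _ => by simp) (fun u _ => rfl) hp hpv hp0]
  have h0 : weight c (0 : V → ℝ) = 1 := by simp [weight, energy]
  rw [h0, one_mul, ← lintegral_mul_const _ (by fun_prop)]
  refine lintegral_congr fun s => ?_
  have : (∫⋯∫⁻_U, fun ζ => g ((0 + s • p + ζ) v) * weight c ζ) 0
      = (∫⋯∫⁻_U, fun ζ => g s * weight c ζ) 0 :=
    lmarginal_zero_congr fun ζ hζ => by simp [hpv, hζ v hv]
  rw [this, lmarginal_const_mul (measurable_weight c)]
  simp only [map_zero, Pi.zero_apply, mul_zero, zero_add]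
  ring

theorem lmarginal_weight_lt_top (hs : ∀ u v, c u v = c v u) (hc : ∀ u v, 0 ≤ c u v)
    (hconst : ∀ φ : V → ℝ, energy c φ = 0 → ∀ u v, φ u = φ v) (hv₀ : v₀ ∉ U) :
    (∫⋯∫⁻_U, weight c) 0 < ∞ := by
  induction U using Finset.induction with
  | empty => simp [weight]
  | insert v U hv ih =>
    obtain ⟨p, hp, hpv, hp0, -, -, hC, -⟩ := exists_potential hs hc hconst hv₀ hv
    have := lmarginal_insert_weight hs hv hp hpv hp0 (g := fun _ => 1) measurable_const
    simp only [one_mul] at this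
    rw [show (∫⋯∫⁻_insert v U, weight c) 0 = (∫⋯∫⁻_insert v U, fun φ => weight c φ) 0 from rfl,
      this]
    exact ENNReal.mul_lt_top (lintegral_gaussian_lt_top (by positivity))
      (ih fun h => hv₀ (Finset.mem_insert_of_mem h))

/-- The value at `u` is a centred Gaussian whose variance is the inverse of the effective
conductance, and the edge to the pinned `r` makes the latter at least `1`. -/
theorem lmarginal_abs_mul_weight_le (hs : ∀ u v, c u v = c v u) (hc : ∀ u v, 0 ≤ c u v)
    (hconst : ∀ φ : V → ℝ, energy c φ = 0 → ∀ u v, φ u = φ v) (hv₀ : v₀ ∉ U) {u r : V}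
    (hr : r ∉ U) (hur : 1 ≤ c u r) :
    (∫⋯∫⁻_U, fun ζ => ENNReal.ofReal |ζ u| * weight c ζ) 0 ≤ (∫⋯∫⁻_U, weight c) 0 := by
  by_cases hu : u ∈ U
  · obtain ⟨U, hu', rfl⟩ : ∃ U', u ∉ U' ∧ U = insert u U' :=
      ⟨U.erase u, Finset.notMem_erase u U, (Finset.insert_erase hu).symm⟩
    obtain ⟨p, hp, hpv, hp0, -, -, -, hC⟩ := exists_potential hs hc hconst hv₀ hu'
    have h1 := lmarginal_insert_weight hs hu' hp hpv hp0 (g := fun _ => 1) measurable_const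
    have h2 := lmarginal_insert_weight hs hu' hp hpv hp0 (g := fun s => ENNReal.ofReal |s|)
      (by fun_prop)
    simp only [one_mul] at h1
    rw [h2, show (∫⋯∫⁻_insert u U, weight c) 0 = (∫⋯∫⁻_insert u U, fun φ => weight c φ) 0 from rfl,
      h1]
    gcongr ?_ * _
    exact lintegral_abs_mul_gaussian_le (by linarith [hC r hr])
  · exact lmarginal_zero_mono fun ζ hζ => by simp [hζ u hu]

/-- Markov's inequality for the field at the neighbours of a pinned vertex. -/
theorem lmarginal_weight_le_two_mul (hs : ∀ u v, c u v = c v u) (hc : ∀ u v, 0 ≤ c u v)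
    (hconst : ∀ φ : V → ℝ, energy c φ = 0 → ∀ u v, φ u = φ v) (hv₀ : v₀ ∉ U) {v : V}
    (hv : v ∉ U) {N : Finset V} (hN : ∀ u ∈ N, 1 ≤ c u v) {D : ℝ} (hD : 0 < D) (hND : N.card ≤ D) :
    (∫⋯∫⁻_U, weight c) 0 ≤
      2 * (∫⋯∫⁻_U, fun ζ => {ζ : V → ℝ | ∑ u ∈ N, |ζ u| ≤ 2 * D}.indicator 1 ζ * weight c ζ) 0 := by
  set Z := (∫⋯∫⁻_U, weight c) 0
  set A : Set (V → ℝ) := {ζ : V → ℝ | ∑ u ∈ N, |ζ u| ≤ 2 * D}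
  have hA : MeasurableSet A := measurableSet_le (by fun_prop) measurable_const
  set I := (∫⋯∫⁻_U, fun ζ => A.indicator 1 ζ * weight c ζ) 0
  have hmI : Measurable fun ζ => A.indicator 1 ζ * weight c ζ :=
    (measurable_one.indicator hA).mul (measurable_weight c)
  have hZt : Z ≠ ∞ := (lmarginal_weight_lt_top hs hc hconst hv₀).ne
  have hm : ∀ u : V, Measurable fun ζ : V → ℝ => ENNReal.ofReal |ζ u| * weight c ζ := fun u =>
    Measurable.mul (by fun_prop) (measurable_weight c)
  -- Markov's inequality in additive form. The last term is finite, so it can be cancelled against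
  -- half of the left side.
  have h1 : ENNReal.ofReal (2 * D) * Z ≤ ENNReal.ofReal (2 * D) * I + ENNReal.ofReal D * Z := by
    have hpt : ∀ ζ : V → ℝ, ENNReal.ofReal (2 * D) * weight c ζ ≤
        ENNReal.ofReal (2 * D) * (A.indicator 1 ζ * weight c ζ) +
          ∑ u ∈ N, ENNReal.ofReal |ζ u| * weight c ζ := fun ζ => by
      by_cases h : ζ ∈ A
      · simp [h]
      · rw [← Finset.sum_mul, ← ENNReal.ofReal_sum_of_nonneg fun u _ => abs_nonneg _]
        refine le_add_left ?_
        gcongr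
        exact (not_le.mp h).le
    have h2 : (∫⋯∫⁻_U, fun ζ => ENNReal.ofReal (2 * D) * weight c ζ) 0 ≤
        (∫⋯∫⁻_U, fun ζ => ENNReal.ofReal (2 * D) * (A.indicator 1 ζ * weight c ζ) +
          ∑ u ∈ N, ENNReal.ofReal |ζ u| * weight c ζ) 0 :=
      lmarginal_zero_mono fun ζ _ => hpt ζ
    rw [lmarginal_const_mul (measurable_weight c), lmarginal_add (hmI.const_mul _),
      lmarginal_const_mul hmI, lmarginal_sum _ hm] at h2
    refine h2.trans ?_
    gcongr
    calc _ ≤ ∑ u ∈ N, Z := Finset.sum_le_sum fun u hu =>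
          lmarginal_abs_mul_weight_le hs hc hconst hv₀ hv (hN u hu)
      _ = ENNReal.ofReal N.card * Z := by simp
      _ ≤ _ := by gcongr
  have hDZ : ENNReal.ofReal D * Z ≠ ∞ := ENNReal.mul_ne_top ENNReal.ofReal_ne_top hZt
  have h3 : ENNReal.ofReal D * Z ≤ ENNReal.ofReal (2 * D) * I := by
    refine (ENNReal.add_le_add_iff_right hDZ).mp (le_trans (le_of_eq ?_) h1)
    rw [← add_mul, ← ENNReal.ofReal_add hD.le hD.le, two_mul]
  rw [mul_comm 2 D, ENNReal.ofReal_mul hD.le, mul_assoc] at h3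
  have := (ENNReal.mul_le_mul_iff_right (ENNReal.ofReal_pos.mpr hD).ne' ENNReal.ofReal_ne_top).mp h3
  simpa using this

end Moments

/-! ### The capped ratio at the first vertex above the level -/

section Overshoot

variable {V : Type*} [Fintype V] [DecidableEq V] {E : Finset (Sym2 V)} {U : Finset V} {v₀ : V}

theorem le_cappedRatio {Δ S y : ℝ} (hS : 0 ≤ S) (hy : y ≤ 1) (hyS : y * S ≤ Δ) :
    y ≤ cappedRatio Δ S := by
  unfold cappedRatio
  split_ifs with h
  · exact hy
  · exact le_min hy ((le_div_iff₀ (lt_of_le_of_ne hS (Ne.symm h))).mpr hyS)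

theorem measurable_cappedRatio (Δ : ℝ) : Measurable (cappedRatio Δ) :=
  Measurable.ite (measurableSet_singleton 0) measurable_const
    (measurable_const.min (measurable_const.div measurable_id))

/-- The field `φ` exceeds the level `M` at `v`, but only by `ε (1 ∧ Δ / ∑_{u ∈ N_v} |M - φ_u|)`. -/
def SmallOvershoot (E : Finset (Sym2 V)) (Δ ε M : ℝ) (v : V) : Set (V → ℝ) :=
  {φ | M ≤ φ v ∧ φ v ≤ M + ε * cappedRatio Δ (∑ u ∈ neighbors E v, |M - φ u|)}

theorem measurableSet_smallOvershoot (Δ ε M : ℝ) (v : V) :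
    MeasurableSet (SmallOvershoot E Δ ε M v) := by
  refine (measurableSet_le measurable_const (measurable_pi_apply v)).inter
    (measurableSet_le (measurable_pi_apply v) (measurable_const.add (measurable_const.mul ?_)))
  exact (measurable_cappedRatio Δ).comp (by fun_prop)

theorem mem_neighbors {u v : V} : u ∈ neighbors E v ↔ s(v, u) ∈ E := by
  simp [neighbors]

theorem card_neighbors_le_degree (v : V) : (neighbors E v).card ≤ degree E v := by
  calc ((neighbors E v).card : ℝ) = ∑ u ∈ neighbors E v, (1 : ℝ) := by simp
    _ ≤ ∑ u ∈ neighbors E v, conductance E v u :=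
        Finset.sum_le_sum fun u hu => one_le_conductance (mem_neighbors.mp hu)
    _ ≤ degree E v := Finset.sum_le_sum_of_subset_of_nonneg (Finset.subset_univ _)
        fun u _ _ => conductance_nonneg E v u

theorem sum_neighbors_le_laplacian {ψ : V → ℝ} {v : V} (h : ∀ u, ψ u ≤ ψ v) :
    ∑ u ∈ neighbors E v, (ψ v - ψ u) ≤ laplacian (conductance E) ψ v := by
  calc ∑ u ∈ neighbors E v, (ψ v - ψ u)
      ≤ ∑ u ∈ neighbors E v, conductance E v u * (ψ v - ψ u) :=
        Finset.sum_le_sum fun u hu => le_mul_of_one_le_left (sub_nonneg.mpr (h u))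
          (one_le_conductance (mem_neighbors.mp hu))
    _ ≤ _ := Finset.sum_le_sum_of_subset_of_nonneg (Finset.subset_univ _)
        fun u _ _ => mul_nonneg (conductance_nonneg E v u) (sub_nonneg.mpr (h u))

/-- A vertex of degree less than `2` has a single neighbour. -/
theorem eq_of_mem_neighbors_of_degree_lt {v r u : V} (hd : degree E v < 2)
    (hr : r ∈ neighbors E v) (hu : u ∈ neighbors E v) : u = r := by
  by_contra h
  have h1 : (2 : ℕ) ≤ (neighbors E v).card := by
    rw [← Finset.card_pair h]
    exact Finset.card_le_card fun w hw => by
      rcases Finset.mem_insert.mp hw with rfl | hw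
      · exact hu
      · rwa [Finset.mem_singleton.mp hw]
  have h2 := card_neighbors_le_degree (E := E) v
  have h3 : (2 : ℝ) ≤ (neighbors E v).card := by exact_mod_cast h1
  linarith

/-- Given the values off `U` and `φ v = M + s` for small `s`, the field at the neighbours of `v`
is close enough to `M` with a probability that is bounded below. -/
theorem exists_capped_bound (hconn : IsConnected E) {Δ : ℝ} {v : V} (hΔ : degree E v ≤ Δ)
    (hv₀ : v₀ ∉ insert v U) (hv : v ∉ U) {r : V} (hr : r ∉ insert v U) (hvr : s(v, r) ∈ E) :
    ∃ κ q : ℝ, 0 ≤ κ ∧ κ ≤ 1 ∧ 0 ≤ q ∧ 2 / (10 : ℝ) ^ Δ ≤ 3 / 8 * κ * q ∧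
      ∀ ψ p : V → ℝ, (∀ u, ψ u ≤ ψ v) → (∀ u, 0 ≤ p u) → (∀ u, p u ≤ 1) →
        (∀ u ∉ insert v U, p u = 0) → ∀ s : ℝ, 0 ≤ s → s ≤ 1 →
        ENNReal.ofReal q * (∫⋯∫⁻_U, weight (conductance E)) 0 ≤
          (∫⋯∫⁻_U, fun ζ => {ζ : V → ℝ | κ / (1 + laplacian (conductance E) ψ v) ≤ cappedRatio Δ
            (∑ u ∈ neighbors E v, |ψ v - (ψ + s • p + ζ) u|)}.indicator 1 ζ *
              weight (conductance E) ζ) 0 := by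
  have hrN : r ∈ neighbors E v := mem_neighbors.mpr hvr
  have hv₀' : v₀ ∉ U := fun h => hv₀ (Finset.mem_insert_of_mem h)
  have hcard := (card_neighbors_le_degree (E := E) v).trans hΔ
  have hΔ1 : 1 ≤ Δ := le_trans
    (by exact_mod_cast Finset.card_pos.mpr ⟨r, hrN⟩) hcard
  -- When `Δ < 2`, the only neighbour of `v` is the revealed `r`, so the neighbour sum is
  -- deterministic and at most `a`. No probability is lost, and `3 / 8 ≥ 2 / 10`.
  rcases lt_or_ge Δ 2 with h2 | h2
  · refine ⟨1, 1, zero_le_one, le_rfl, zero_le_one, ?_, ?_⟩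
    · have : (10 : ℝ) ^ (1 : ℝ) ≤ 10 ^ Δ := Real.rpow_le_rpow_of_exponent_le (by norm_num) hΔ1
      rw [Real.rpow_one] at this
      rw [div_le_iff₀ (by positivity)]
      linarith
    intro ψ p hψ hp0 hp1 hpU s hs0 hs1
    have ha := sum_neighbors_le_laplacian (E := E) hψ
    have ha0 : 0 ≤ ∑ u ∈ neighbors E v, (ψ v - ψ u) :=
      Finset.sum_nonneg fun u _ => sub_nonneg.mpr (hψ u)
    rw [ENNReal.ofReal_one, one_mul]
    refine lmarginal_zero_mono fun ζ hζ => ?_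
    rw [Set.indicator_of_mem, Pi.one_apply, one_mul]
    have hS : ∑ u ∈ neighbors E v, |ψ v - (ψ + s • p + ζ) u|
        = ∑ u ∈ neighbors E v, (ψ v - ψ u) := Finset.sum_congr rfl fun u hu => by
      have hur := eq_of_mem_neighbors_of_degree_lt (hΔ.trans_lt h2) hrN hu
      rw [hur]
      simp only [Pi.add_apply, Pi.smul_apply, hpU r hr,
        hζ r fun h => hr (Finset.mem_insert_of_mem h), smul_zero, add_zero]
      exact abs_of_nonneg (sub_nonneg.mpr (hψ r))
    rw [Set.mem_ofPred_eq, hS]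
    refine le_cappedRatio ha0 ((div_le_one (by linarith)).mpr (by linarith)) ?_
    rw [div_mul_eq_mul_div, div_le_iff₀ (by linarith)]
    nlinarith
  -- The factor `1 / 2` comes from Markov's inequality, and `κ = 1 / 3` from `a + 3 * Δ ≤ 3 * Δ * (1
  -- + a)`, valid as `Δ ≥ 1`. The product `3 / 8 * (1 / 3) * (1 / 2) = 1 / 16` exceeds `2 / 100`.
  · refine ⟨1 / 3, 1 / 2, by norm_num, by norm_num, by norm_num, ?_, ?_⟩
    · have : (10 : ℝ) ^ (2 : ℝ) ≤ 10 ^ Δ := Real.rpow_le_rpow_of_exponent_le (by norm_num) h2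
      rw [Real.rpow_two] at this
      rw [div_le_iff₀ (by positivity)]
      linarith
    intro ψ p hψ hp0 hp1 hpU s hs0 hs1
    have ha := sum_neighbors_le_laplacian (E := E) hψ
    have ha0 : 0 ≤ ∑ u ∈ neighbors E v, (ψ v - ψ u) :=
      Finset.sum_nonneg fun u _ => sub_nonneg.mpr (hψ u)
    have hmarkov := lmarginal_weight_le_two_mul (conductance_comm E) (conductance_nonneg E)
      (eq_of_energy_eq_zero hconn) hv₀' hv (N := neighbors E v)
      (fun u hu => by
        rw [conductance_comm]
        exact one_le_conductance (mem_neighbors.mp hu)) (show 0 < Δ by linarith) hcard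
    have hhalf : ENNReal.ofReal (1 / 2) * 2 = 1 := by
      rw [← ENNReal.ofReal_ofNat, ← ENNReal.ofReal_mul (by norm_num)]
      norm_num
    refine le_trans (mul_le_mul_right hmarkov _) ?_
    rw [← mul_assoc, hhalf, one_mul]
    refine lmarginal_zero_mono fun ζ hζ => ?_
    gcongr ?_ * _
    refine Set.indicator_le_indicator_of_subset ?_ (fun _ => zero_le) ζ
    intro ζ hζ
    have hζ : ∑ u ∈ neighbors E v, |ζ u| ≤ 2 * Δ := hζ
    have hS : ∑ u ∈ neighbors E v, |ψ v - (ψ + s • p + ζ) u|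
        ≤ laplacian (conductance E) ψ v + 3 * Δ := by
      calc ∑ u ∈ neighbors E v, |ψ v - (ψ + s • p + ζ) u|
          ≤ ∑ u ∈ neighbors E v, ((ψ v - ψ u) + 1 + |ζ u|) := Finset.sum_le_sum fun u _ => by
            have h1 : s * p u ≤ 1 := mul_le_one₀ hs1 (hp0 u) (hp1 u)
            have h0 : 0 ≤ s * p u := mul_nonneg hs0 (hp0 u)
            have h3 := hψ u
            simp only [Pi.add_apply, Pi.smul_apply, smul_eq_mul]
            rw [abs_le]
            constructor <;> linarith [le_abs_self (ζ u), neg_abs_le (ζ u)]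
        _ = ∑ u ∈ neighbors E v, (ψ v - ψ u) + (neighbors E v).card
              + ∑ u ∈ neighbors E v, |ζ u| := by
            simp [Finset.sum_add_distrib]
        _ ≤ _ := by linarith
    rw [Set.mem_ofPred_eq]
    refine le_cappedRatio (Finset.sum_nonneg fun u _ => abs_nonneg _)
      ((div_le_one (by linarith)).mpr (by linarith)) ?_
    rw [div_mul_eq_mul_div, div_le_iff₀ (by linarith)]
    nlinarith

end Overshoot

/-! ### Exploration of the field -/

section Exploration

variable {V : Type*} [Fintype V] [DecidableEq V] {E : Finset (Sym2 V)} {U : Finset V} {v₀ : V}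

/-- If the field is below `M` off `insert v U`, then, given that it exceeds `M` at `v`, it has a
small overshoot there with a probability that is bounded below. -/
theorem lmarginal_smallOvershoot_ge (hconn : IsConnected E) {Δ ε M : ℝ} (hε0 : 0 ≤ ε)
    (hε1 : ε ≤ 1) {v : V} (hΔ : degree E v ≤ Δ)
    (hv₀ : v₀ ∉ insert v U) (hv : v ∉ U) {r : V} (hr : r ∉ insert v U) (hvr : s(v, r) ∈ E)
    {x : V → ℝ} (hx : ∀ u ∉ insert v U, x u ≤ M) :
    ENNReal.ofReal (2 * ε / (10 : ℝ) ^ Δ) * (∫⋯∫⁻_insert v U, fun φ =>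
        {φ : V → ℝ | M ≤ φ v}.indicator 1 φ * weight (conductance E) φ) x ≤
      (∫⋯∫⁻_insert v U, fun φ =>
        (SmallOvershoot E Δ ε M v).indicator 1 φ * weight (conductance E) φ) x := by
  have hs := conductance_comm E
  have hc := conductance_nonneg E
  have hconst := eq_of_energy_eq_zero hconn
  have hv₀' : v₀ ∉ U := fun h => hv₀ (Finset.mem_insert_of_mem h)
  obtain ⟨κ, q, hκ0, hκ1, hq, hκq, hJ⟩ := exists_capped_bound hconn hΔ hv₀ hv hr hvr
  obtain ⟨p, hp, hpv, hpU, hp0, hp1, -, hpC⟩ := exists_potential hs hc hconst hv₀ hv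
  -- The boundary value at `v` is the level `M` itself, so that `s` is exactly the overshoot, and
  -- `ψ` attains its maximum at `v`.
  obtain ⟨ψ, hψ, hψx⟩ := exists_harmonic_extension hs hconst hv₀' (Function.update x v M)
  have hψv : ψ v = M := by rw [hψx v hv, Function.update_self]
  have hψx' : ∀ u ∉ insert v U, ψ u = x u := fun u hu => by
    rw [Finset.mem_insert, not_or] at hu
    rw [hψx u hu.2, Function.update_of_ne hu.1]
  have hψM : ∀ u, ψ u ≤ ψ v := harmonic_le hs hc hconst hv₀' hψ fun u hu => by
    by_cases h : u = v
    · rw [h]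
    · have : u ∉ insert v U := by simp [h, hu]
      rw [hψx' u this, hψv]
      exact hx u this
  specialize hJ ψ p hψM hp0 hp1 hpU
  have hb : 1 / 2 ≤ laplacian (conductance E) p v / 2 := by
    linarith [hpC r hr, one_le_conductance hvr]
  have ha : 0 ≤ laplacian (conductance E) ψ v :=
    Finset.sum_nonneg fun u _ => mul_nonneg (hc v u) (sub_nonneg.mpr (hψM u))
  set a := laplacian (conductance E) ψ v
  set b := laplacian (conductance E) p v / 2
  set Z := (∫⋯∫⁻_U, weight (conductance E)) 0
  have hmM : MeasurableSet {φ : V → ℝ | M ≤ φ v} :=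
    measurableSet_le measurable_const (measurable_pi_apply v)
  have hmS := measurableSet_smallOvershoot (E := E) Δ ε M v
  rw [lmarginal_insert_mul_weight hs hv (measurable_one.indicator hmM) hψ hψx' hp hpv hpU,
    lmarginal_insert_mul_weight hs hv (measurable_one.indicator hmS) hψ hψx' hp hpv hpU,
    mul_left_comm]
  refine mul_le_mul_right ?_ _
  set g : ℝ → ℝ≥0∞ := fun s => ENNReal.ofReal (Real.exp (-(s * a + s ^ 2 * b))) with hg
  have hgm : Measurable g := by fun_prop
  have hvalue : ∀ (s : ℝ) (ζ : V → ℝ), (∀ u ∉ U, ζ u = 0) → (ψ + s • p + ζ) v = M + s :=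
    fun s ζ hζ => by simp [hψv, hpv, hζ v hv]
  have hupper : ∫⁻ s : ℝ, g s * (∫⋯∫⁻_U, fun ζ => {φ : V → ℝ | M ≤ φ v}.indicator 1
      (ψ + s • p + ζ) * weight (conductance E) ζ) 0 = (∫⁻ s in Set.Ioi (0 : ℝ), g s) * Z := by
    rw [setLIntegral_congr Ioi_ae_eq_Ici, ← lintegral_indicator measurableSet_Ici,
      ← lintegral_mul_const _ (hgm.indicator measurableSet_Ici)]
    refine lintegral_congr fun s => ?_
    by_cases h : 0 ≤ s
    · rw [Set.indicator_of_mem (show s ∈ Set.Ici 0 from h)]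
      congr 1
      refine lmarginal_zero_congr fun ζ hζ => ?_
      rw [Set.indicator_of_mem, Pi.one_apply, one_mul]
      rw [Set.mem_ofPred_eq, hvalue s ζ hζ]
      linarith
    · rw [Set.indicator_of_notMem (show s ∉ Set.Ici 0 from h), zero_mul]
      refine mul_eq_zero_of_right _ ?_
      rw [show (0 : ℝ≥0∞) = (∫⋯∫⁻_U, fun _ => 0) (0 : V → ℝ) by simp [lmarginal]]
      refine lmarginal_zero_congr fun ζ hζ => ?_
      rw [Set.indicator_of_notMem, zero_mul]
      rw [Set.mem_ofPred_eq, hvalue s ζ hζ]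
      linarith
  set t : ℝ := ε * (κ / (1 + a)) with ht
  have ht0 : 0 ≤ t := by positivity
  have hta : t * (1 + a) = ε * κ := by rw [ht]; field_simp
  have hεκ : ε * κ ≤ 1 := mul_le_one₀ hε1 hκ0 hκ1
  -- Needed because the bound on the neighbours holds only for overshoots up to `1`.
  have ht1 : t ≤ 1 := by nlinarith
  have hlower : (∫⁻ s in Set.Ioc 0 t, g s) * (ENNReal.ofReal q * Z) ≤
      ∫⁻ s : ℝ, g s * (∫⋯∫⁻_U, fun ζ => (SmallOvershoot E Δ ε M v).indicator 1
        (ψ + s • p + ζ) * weight (conductance E) ζ) 0 := by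
    rw [← lintegral_indicator measurableSet_Ioc,
      ← lintegral_mul_const _ (hgm.indicator measurableSet_Ioc)]
    refine lintegral_mono fun s => ?_
    by_cases h : s ∈ Set.Ioc 0 t
    · rw [Set.indicator_of_mem h]
      refine mul_le_mul_right ((hJ s h.1.le (h.2.trans ht1)).trans ?_) _
      refine lmarginal_zero_mono fun ζ hζ => ?_
      refine mul_le_mul_left ?_ _
      by_cases hζS : κ / (1 + a) ≤
          cappedRatio Δ (∑ u ∈ neighbors E v, |ψ v - (ψ + s • p + ζ) u|)
      · have hmem : ψ + s • p + ζ ∈ SmallOvershoot E Δ ε M v := by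
          rw [SmallOvershoot, Set.mem_ofPred_eq, hvalue s ζ hζ, ← hψv]
          have := mul_le_mul_of_nonneg_left hζS hε0
          exact ⟨by linarith [h.1], by linarith [h.2]⟩
        rw [Set.indicator_of_mem hmem, Set.indicator_of_mem (by exact hζS)]
        exact le_rfl
      · rw [Set.indicator_of_notMem (by exact hζS)]
        exact zero_le
    · rw [Set.indicator_of_notMem h, zero_mul]
      exact zero_le
  rw [hupper]
  refine le_trans ?_ hlower
  have h1d := lintegral_Ioi_le_lintegral_Ioc ha hb ht0 (hta.trans_le hεκ)
  rw [hta] at h1d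
  calc ENNReal.ofReal (2 * ε / (10 : ℝ) ^ Δ) * ((∫⁻ s in Set.Ioi (0 : ℝ), g s) * Z)
      ≤ ENNReal.ofReal (3 / 8 * (ε * κ) * q) * ((∫⁻ s in Set.Ioi (0 : ℝ), g s) * Z) := by
        refine mul_le_mul_left (ENNReal.ofReal_le_ofReal ?_) _
        have := mul_le_mul_of_nonneg_left hκq hε0
        calc 2 * ε / (10 : ℝ) ^ Δ = ε * (2 / (10 : ℝ) ^ Δ) := by ring
          _ ≤ _ := this
          _ = _ := by ring
    _ = (ENNReal.ofReal (3 / 8 * (ε * κ)) * ∫⁻ s in Set.Ioi (0 : ℝ), g s) *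
          (ENNReal.ofReal q * Z) := by
        rw [ENNReal.ofReal_mul (by positivity)]
        ring
    _ ≤ _ := mul_le_mul_left h1d _

theorem measurableSet_exists_mem_le {V : Type*} (s : Finset V) (M : ℝ) :
    MeasurableSet {φ : V → ℝ | ∃ v ∈ s, M ≤ φ v} := by
  have : {φ : V → ℝ | ∃ v ∈ s, M ≤ φ v} = ⋃ v ∈ s, {φ : V → ℝ | M ≤ φ v} := by
    ext φ
    simp
  rw [this]
  exact s.measurableSet_biUnion fun v _ => measurableSet_le measurable_const (measurable_pi_apply v)

/-- Exploring the vertices one by one from a set containing the pinned vertex, until the level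
`M` is exceeded. -/
theorem lmarginal_exists_smallOvershoot_ge (hconn : IsConnected E) {Δ ε M : ℝ} (hε0 : 0 ≤ ε)
    (hε1 : ε ≤ 1) (hΔ : ∀ v, degree E v ≤ Δ) (hv₀ : v₀ ∉ U)
    {x : V → ℝ} (hx : ∀ u ∉ U, x u < M) :
    ENNReal.ofReal (2 * ε / (10 : ℝ) ^ Δ) * (∫⋯∫⁻_U, fun φ =>
        {φ : V → ℝ | ∃ v ∈ U, M ≤ φ v}.indicator 1 φ * weight (conductance E) φ) x ≤
      (∫⋯∫⁻_U, fun φ =>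
        (⋃ v, SmallOvershoot E Δ ε M v).indicator 1 φ * weight (conductance E) φ) x := by
  induction hn : U.card generalizing U x with
  | zero =>
    rw [Finset.card_eq_zero.mp hn]
    simp
  | succ n ih =>
    obtain ⟨w, hw⟩ : U.Nonempty := Finset.card_pos.mp (by omega)
    obtain ⟨v, hvU, r, hr, hvr⟩ := exists_edge_boundary hconn (R := Uᶜ) (w := w)
      (Finset.mem_compl.mpr hv₀) (by simpa using hw)
    replace hvU : v ∈ U := by simpa using hvU
    replace hr : r ∉ U := by simpa using hr
    obtain ⟨U, hv, rfl⟩ : ∃ U', v ∉ U' ∧ U = insert v U' :=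
      ⟨U.erase v, Finset.notMem_erase v U, (Finset.insert_erase hvU).symm⟩
    have hW := measurable_weight (conductance E)
    set W := weight (conductance E)
    set r₀ := ENNReal.ofReal (2 * ε / (10 : ℝ) ^ Δ)
    set A : Set (V → ℝ) := {φ | ∃ u ∈ insert v U, M ≤ φ u}
    set A' : Set (V → ℝ) := {φ | ∃ u ∈ U, M ≤ φ u}
    set B : Set (V → ℝ) := {φ | M ≤ φ v}
    set S := ⋃ v, SmallOvershoot E Δ ε M v
    have hA' : MeasurableSet A' := measurableSet_exists_mem_le U M
    have hB : MeasurableSet B := measurableSet_le measurable_const (measurable_pi_apply v)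
    have hSv : MeasurableSet (SmallOvershoot E Δ ε M v) := measurableSet_smallOvershoot Δ ε M v
    have hS : MeasurableSet S := MeasurableSet.iUnion fun v => measurableSet_smallOvershoot Δ ε M v
    have hmul : ∀ {T : Set (V → ℝ)}, MeasurableSet T → Measurable fun φ => T.indicator 1 φ * W φ :=
      fun hT => (measurable_one.indicator hT).mul hW
    have hsplitA : (∫⋯∫⁻_insert v U, fun φ => A.indicator 1 φ * W φ) x ≤
        (∫⋯∫⁻_insert v U, fun φ => B.indicator 1 φ * W φ) x +
          (∫⋯∫⁻_insert v U, fun φ => (A' \ B).indicator 1 φ * W φ) x := by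
      rw [← lmarginal_add (hmul hB)]
      refine lmarginal_mono (fun φ => ?_) x
      rw [← add_mul]
      refine mul_le_mul_left ?_ _
      by_cases h : φ ∈ B
      · rw [Set.indicator_of_mem h]
        exact le_add_right (Set.indicator_le_self _ _ φ)
      · by_cases h' : φ ∈ A
        · have : φ ∈ A' \ B := by
            obtain ⟨u, hu, huM⟩ := h'
            rcases Finset.mem_insert.mp hu with rfl | hu
            · exact absurd huM h
            · exact ⟨⟨u, hu, huM⟩, h⟩
          rw [Set.indicator_of_mem this]
          exact le_add_left (Set.indicator_le_self _ _ φ)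
        · rw [Set.indicator_of_notMem h']
          exact zero_le
    -- A small overshoot at `v` forces `φ ∈ B`, so it is disjoint from the event `S \ B` handled by
    -- the later steps.
    have hsplitS : (∫⋯∫⁻_insert v U, fun φ => (SmallOvershoot E Δ ε M v).indicator 1 φ * W φ) x +
        (∫⋯∫⁻_insert v U, fun φ => (S \ B).indicator 1 φ * W φ) x ≤
          (∫⋯∫⁻_insert v U, fun φ => S.indicator 1 φ * W φ) x := by
      rw [← lmarginal_add (hmul hSv)]
      refine lmarginal_mono (fun φ => ?_) x
      rw [← add_mul]
      refine mul_le_mul_left ?_ _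
      by_cases h : φ ∈ SmallOvershoot E Δ ε M v
      · rw [Set.indicator_of_notMem (show φ ∉ S \ B from fun h' => h'.2 h.1), add_zero]
        exact Set.indicator_le_indicator_of_subset (Set.subset_iUnion _ v) (fun _ => zero_le) φ
      · rw [Set.indicator_of_notMem h, zero_add]
        exact Set.indicator_le_indicator_of_subset Set.sdiff_subset (fun _ => zero_le) φ
    have hfibre : r₀ * (∫⋯∫⁻_insert v U, fun φ => (A' \ B).indicator 1 φ * W φ) x ≤
        (∫⋯∫⁻_insert v U, fun φ => (S \ B).indicator 1 φ * W φ) x := by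
      rw [lmarginal_insert (fun φ => (A' \ B).indicator 1 φ * W φ) (hmul (hA'.diff hB)) hv,
        lmarginal_insert (fun φ => (S \ B).indicator 1 φ * W φ) (hmul (hS.diff hB)) hv,
        ← lintegral_const_mul' _ _ ENNReal.ofReal_ne_top]
      refine lintegral_mono fun y => ?_
      have hval : ∀ z : U → ℝ, Function.updateFinset (Function.update x v y) U z v = y :=
        fun z => by simp [Function.updateFinset, hv]
      -- Off `B` the value revealed at `v` is below `M`, which is the induction hypothesis's
      -- condition on the boundary values.
      by_cases hy : M ≤ y
      · have : (∫⋯∫⁻_U, fun φ => (A' \ B).indicator 1 φ * W φ) (Function.update x v y) = 0 := by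
          unfold lmarginal
          rw [lintegral_eq_zero_of_ae_eq_zero]
          refine ae_of_all _ fun z => ?_
          refine mul_eq_zero_of_left (Set.indicator_of_notMem (fun h => h.2 ?_) _) _
          exact (show M ≤ _ by rwa [hval z])
        rw [this, mul_zero]
        exact zero_le
      · have hdiff : ∀ T : Set (V → ℝ),
            (∫⋯∫⁻_U, fun φ => (T \ B).indicator 1 φ * W φ) (Function.update x v y) =
              (∫⋯∫⁻_U, fun φ => T.indicator 1 φ * W φ) (Function.update x v y) := fun T => by
          unfold lmarginal
          refine lintegral_congr fun z => ?_
          have hz : Function.updateFinset (Function.update x v y) U z ∉ B := fun h =>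
            hy (by rw [← hval z]; exact h)
          refine congrArg (· * W _) ?_
          by_cases hT : Function.updateFinset (Function.update x v y) U z ∈ T
          · rw [Set.indicator_of_mem hT, Set.indicator_of_mem (show _ ∈ T \ B from ⟨hT, hz⟩)]
          · rw [Set.indicator_of_notMem hT, Set.indicator_of_notMem (show _ ∉ T \ B from fun h => hT h.1)]
        rw [hdiff, hdiff]
        refine ih (fun h => hv₀ (Finset.mem_insert_of_mem h)) (fun u hu => ?_) ?_
        · by_cases h : u = v
          · rw [h, Function.update_self]
            exact not_le.mp hy
          · rw [Function.update_of_ne h]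
            exact hx u (by simp [h, hu])
        · rw [Finset.card_insert_of_notMem hv] at hn
          omega
    calc r₀ * (∫⋯∫⁻_insert v U, fun φ => A.indicator 1 φ * W φ) x
        ≤ r₀ * (∫⋯∫⁻_insert v U, fun φ => B.indicator 1 φ * W φ) x +
            r₀ * (∫⋯∫⁻_insert v U, fun φ => (A' \ B).indicator 1 φ * W φ) x := by
          rw [← mul_add]
          exact mul_le_mul_right hsplitA _
      _ ≤ _ := add_le_add (lmarginal_smallOvershoot_ge hconn hε0 hε1 (hΔ v) hv₀ hv hr hvr
            fun u hu => (hx u hu).le) hfibre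
      _ ≤ _ := hsplitS

end Exploration

/-! ### From the law of the field to marginal integrals -/

section Law

variable {V : Type*} [Fintype V] [DecidableEq V] {c : V → V → ℝ} {v₀ : V}

theorem measurable_pinned {V : Type*} [DecidableEq V] (v₀ : V) : Measurable (pinned v₀) := by
  refine measurable_pi_iff.mpr fun v => ?_
  unfold pinned
  by_cases h : v = v₀
  · simp [h]
  · simpa [h] using measurable_pi_apply _

theorem lintegral_pinned {g : (V → ℝ) → ℝ≥0∞} (hg : Measurable g) :
    ∫⁻ x, g (pinned v₀ x) = (∫⋯∫⁻_Finset.univ.erase v₀, g) 0 := by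
  have h1 := lmarginal_image (μ := fun _ : V => (volume : Measure ℝ))
    (Subtype.val_injective (p := fun v : V => v ≠ v₀)) Finset.univ
    (hg.comp (measurable_pinned v₀)) 0
  have himage : Finset.univ.image (Subtype.val : {v : V // v ≠ v₀} → V)
      = Finset.univ.erase v₀ := by
    ext v
    simp
  rw [himage, lmarginal_univ] at h1
  rw [volume_pi]
  refine h1.symm.trans (lmarginal_zero_congr fun ζ hζ => congrArg g ?_)
  funext v
  by_cases h : v = v₀
  · simp [pinned, h, hζ v₀ (by simp)]
  · simp [pinned, h]

theorem gffLaw_apply {S : Set (V → ℝ)} (hS : MeasurableSet S) :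
    gffLaw c v₀ S = (unnormalized c v₀ Set.univ)⁻¹ *
      (∫⋯∫⁻_Finset.univ.erase v₀, fun φ => S.indicator 1 φ * weight c φ) 0 := by
  have hm := measurable_pinned v₀
  rw [gffLaw, Measure.map_apply hm hS, Measure.smul_apply, smul_eq_mul, unnormalized,
    withDensity_apply _ (hm hS), ← lintegral_indicator (hm hS),
    ← lintegral_pinned (g := fun φ => S.indicator 1 φ * weight c φ)
      ((measurable_one.indicator hS).mul (measurable_weight c))]
  congr 1
  refine lintegral_congr fun x => ?_
  by_cases h : pinned v₀ x ∈ S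
  · rw [Set.indicator_of_mem (show x ∈ pinned v₀ ⁻¹' S from h),
      Set.indicator_of_mem h, Pi.one_apply, one_mul]
    rfl
  · rw [Set.indicator_of_notMem (show x ∉ pinned v₀ ⁻¹' S from h),
      Set.indicator_of_notMem h, zero_mul]

end Law

end GaussianFreeField

/-! ### The main theorem -/

open GaussianFreeField in
theorem proposition3p4 {V : Type*} [Fintype V] [DecidableEq V]
    (E : Finset (Sym2 V)) (hconn : IsConnected E)
    (Δ : ℝ) (hΔ : ∀ v, degree E v ≤ Δ) (v₀ : V)
    {Ω : Type*} [MeasurableSpace Ω] (P : Measure Ω) [IsProbabilityMeasure P]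
    (η : V → Ω → ℝ) (hη : IsGFF E v₀ η P)
    (ε : ℝ) (hε0 : 0 ≤ ε) (hε1 : ε ≤ 1) (M : ℝ) (hM : 0 < M) :
    2 * ε / (10 : ℝ) ^ Δ * P.real {ω | M ≤ ⨆ v, η v ω} ≤
      P.real {ω | ∃ v, M ≤ η v ω ∧
        η v ω ≤ M + ε * cappedRatio Δ (∑ u ∈ neighbors E v, |M - η u ω|)} := by
  have hlaw : HasLaw (fun ω v => η v ω) (gffLaw (conductance E) v₀) P := hη
  have hS : MeasurableSet (⋃ v, SmallOvershoot E Δ ε M v) :=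
    MeasurableSet.iUnion fun v => measurableSet_smallOvershoot Δ ε M v
  have hA := measurableSet_exists_mem_le (Finset.univ.erase v₀) M
  have hsup : ∀ φ : V → ℝ, M ≤ ⨆ v, φ v ↔ ∃ v ∈ Finset.univ, M ≤ φ v := fun φ => by
    have : Nonempty V := ⟨v₀⟩
    constructor
    · intro h
      obtain ⟨v, hv⟩ := exists_eq_ciSup_of_finite (f := φ)
      exact ⟨v, Finset.mem_univ v, hv ▸ h⟩
    · rintro ⟨v, -, hv⟩
      exact hv.trans (le_ciSup (Set.finite_range φ).bddAbove v)
  have hleft : P {ω | M ≤ ⨆ v, η v ω} =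
      gffLaw (conductance E) v₀ {φ | ∃ v ∈ Finset.univ, M ≤ φ v} := by
    rw [← hlaw.measure_eq (measurableSet_exists_mem_le Finset.univ M)]
    congr 1
    ext ω
    exact hsup fun v => η v ω
  have hright : P {ω | ∃ v, M ≤ η v ω ∧
        η v ω ≤ M + ε * cappedRatio Δ (∑ u ∈ neighbors E v, |M - η u ω|)} =
      gffLaw (conductance E) v₀ (⋃ v, SmallOvershoot E Δ ε M v) := by
    rw [← Set.ofPred_mem_eq (s := ⋃ v, SmallOvershoot E Δ ε M v)] at hS ⊢
    rw [← hlaw.measure_eq hS]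
    congr 1
    ext ω
    simp [SmallOvershoot]
  have hkey : ENNReal.ofReal (2 * ε / (10 : ℝ) ^ Δ) *
      gffLaw (conductance E) v₀ {φ | ∃ v ∈ Finset.univ, M ≤ φ v} ≤
        gffLaw (conductance E) v₀ (⋃ v, SmallOvershoot E Δ ε M v) := by
    rw [gffLaw_apply (measurableSet_exists_mem_le Finset.univ M), gffLaw_apply hS, mul_left_comm]
    refine mul_le_mul_right ?_ _
    -- The pinned vertex may be dropped from the supremum event because its value `0` is below `M`.
    -- The normalising constant is a common factor.
    refine le_trans (mul_le_mul_right (lmarginal_zero_mono fun ζ hζ => ?_) _)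
      (lmarginal_exists_smallOvershoot_ge hconn hε0 hε1 hΔ (Finset.notMem_erase v₀ Finset.univ)
        (x := 0) fun _ _ => hM)
    refine mul_le_mul_left ?_ _
    by_cases h : ζ ∈ {φ : V → ℝ | ∃ v ∈ Finset.univ, M ≤ φ v}
    · obtain ⟨v, -, hv⟩ := h
      rw [Set.indicator_of_mem
        (show ζ ∈ {φ : V → ℝ | ∃ v ∈ Finset.univ.erase v₀, M ≤ φ v} from ⟨v, ?_, hv⟩)]
      · exact Set.indicator_le_self _ _ ζ
      · refine Finset.mem_erase.mpr ⟨fun h => ?_, Finset.mem_univ v⟩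
        rw [h, hζ v₀ (by simp)] at hv
        linarith
    · rw [Set.indicator_of_notMem h]
      exact zero_le
  rw [← hleft, ← hright] at hkey
  have := ENNReal.toReal_mono (measure_ne_top P _) hkey
  rwa [ENNReal.toReal_mul, ENNReal.toReal_ofReal (by positivity)] at this
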